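/- Let $\mathbb{D}=\{z\in\mathbb{C}:|z|<1\}$ and $\mathbb{T}=\{z\in\mathbb{C}:|z|=1\}$. For a holomorphic function $f(z)=\sum_{k\ge 0}a_kz^k$ on $\mathbb{D}$ and $n\in\mathbb{N}$ write $S_n(f)(z)=\sum_{k=0}^{n}a_kz^k$. Let $\mathcal{U}(\mathbb{D},\mathbb{T})$ be the set of $\mathbb{T}$-universal Taylor series, that is, of all holomorphic functions $f$ on $\mathbb{D}$ with the following property: for every compact set $K\subset\mathbb{T}$ with $K\neq\mathbb{T}$ and every continuous function $\varphi:K\to\mathbb{C}$ there is a strictly increasing sequence $(\lambda_n)_n$ of natural numbers such that $$\sup_{\zeta\in K}\left|S_{\lambda_n}(f)(\zeta)-\varphi(\zeta)\right|\to 0\quad\text{as }n\to\infty.$$ **Theorem.** For every integer $l\ge 1$ there exists $f\in\mathcal{U}(\mathbb{D},\mathbb{T})$ whose $l$-th derivative satisfies $f^{(l)}\notin\mathcal{U}(\mathbb{D},\mathbb{T})$. -/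

import Mathlib

open Filter Topology

/-- The `n`-th partial sum `S_n(f)(z) = ∑_{k=0}^{n} a_k z^k` of the Taylor expansion of `f` at `0`,
where `a_k = f^{(k)}(0) / k!`. -/
noncomputable def taylorPartialSum (f : ℂ → ℂ) (n : ℕ) (z : ℂ) : ℂ :=
  ∑ k ∈ Finset.range (n + 1), iteratedDeriv k f 0 / (Nat.factorial k : ℂ) * z ^ k

/-- The set of `𝕋`-universal Taylor series: the functions `f` holomorphic in the open unit disc
such that for every compact subset `K` of the unit circle other than the whole circle and every
function `φ` continuous on `K`, there is a (strictly) increasing sequence `u` of natural numbers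
such that the partial sums `S_{u n}(f)` converge to `φ` uniformly on `K`.

Elements of `H(𝔻)` are represented by functions on `ℂ`; their values off the open unit disc
play no role. -/
def TUniversalTaylorSeries : Set (ℂ → ℂ) :=
  {f | DifferentiableOn ℂ f (Metric.ball 0 1) ∧
    ∀ K : Set ℂ, IsCompact K → K ⊆ Metric.sphere 0 1 → K ≠ Metric.sphere 0 1 →
      ∀ φ : ℂ → ℂ, ContinuousOn φ K →
        ∃ u : ℕ → ℕ, StrictMono u ∧
          TendstoUniformlyOn (fun n => taylorPartialSum f (u n)) φ atTop K}

/-! The partial sums of `f^(l)` at `1` are sums of `k(k-1)...(k-l+1) a_k`. If all of them have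
modulus at least `1`, they cannot approximate `0` on `{1}`, so `f^(l)` is not universal. It remains
to build a universal `f` under this constraint.

Universality comes from successive polynomial corrections: each is tiny on a disc, steers the sum
towards a target on an arc-like set `K`, and vanishes to high order at `0`. The heart is
`exists_polynomial_approx_of_one_le_norm`. A correction `F` is built with order of vanishing above
`t²` and degree `O(t²)`, so only `O(t²)` values of the weighted sums can be too small. By pigeonhole
on a grid (`exists_translation_one_le_norm`) a translation `v` of size `O(t)` pushes them all out of
the unit disc. The extra term `a z^(t²)` realises this translation; its weight is at least `t²`
because `l ≥ 1`, so `a = O(1/t)` is negligible. -/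

/-! ### Polynomial approximation on compact sets with connected complement -/

open Polynomial in
/-- Runge's theorem for reciprocals of polynomials on a compact set with connected complement. -/
theorem exists_polynomial_near_inv {L : Set ℂ} (hL : IsCompact L) (hc : IsPreconnected Lᶜ)
    (q : ℂ[X]) (hq : ∀ z ∈ L, q.eval z ≠ 0) {ε : ℝ} (hε : 0 < ε) :
    ∃ p : ℂ[X], ∀ z ∈ L, ‖p.eval z - (q.eval z)⁻¹‖ < ε := by
  rcases L.eq_empty_or_nonempty with rfl | hne
  · exact ⟨0, by simp⟩
  have : CompactSpace L := isCompact_iff_compactSpace.mp hL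
  have : Nonempty L := hne.to_subtype
  let S : Subalgebra ℂ C(L, ℂ) := (polynomialFunctions L).topologicalClosure
  have hS : IsClosed (S : Set C(L, ℂ)) := Subalgebra.isClosed_topologicalClosure _
  have : CompleteSpace S := hS.completeSpace_coe
  have hmem : ∀ p : ℂ[X], p.toContinuousMapOn L ∈ S := fun p =>
    Subalgebra.le_topologicalClosure _ ⟨p, trivial, rfl⟩
  let x : S := ⟨(X : ℂ[X]).toContinuousMapOn L, hmem X⟩
  have hx : spectrum ℂ (x : C(L, ℂ)) = L := by
    rw [ContinuousMap.spectrum_eq_range]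
    ext z
    simp [x]
  have hxS : spectrum ℂ x = L := by
    -- Spectral permanence: passing to a closed subalgebra can only fill holes of the spectrum, and
    -- `L` has none. Hence `q`, nonzero on `L`, is invertible inside the closure of the polynomials.
    rw [Subalgebra.spectrum_eq_of_isPreconnected_compl S x (by rwa [hx]), hx]
  have hcoe : ((aeval x q : S) : C(L, ℂ)) = q.toContinuousMapOn L := by
    rw [← S.coe_val, ← aeval_algHom_apply]
    ext z
    simp [x, aeval_continuousMap_apply]
  have hu : IsUnit (aeval x q) := by
    rw [← spectrum.zero_notMem_iff ℂ,
      spectrum.map_polynomial_aeval_of_nonempty x q (by rw [hxS]; exact hne), hxS]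
    rintro ⟨z, hz, h0⟩
    exact hq z hz h0
  obtain ⟨y, hy⟩ := hu.exists_right_inv
  have hyv : ∀ z : L, (y : C(L, ℂ)) z = (q.eval (z : ℂ))⁻¹ := by
    intro z
    have h1 : (((aeval x q * y : S) : C(L, ℂ))) z = 1 := by rw [hy]; rfl
    have h2 : (q.eval (z : ℂ)) * (y : C(L, ℂ)) z = 1 := by
      rw [← h1, Subalgebra.coe_mul, hcoe]; rfl
    exact eq_inv_of_mul_eq_one_right h2
  have hycl : (y : C(L, ℂ)) ∈ closure (polynomialFunctions L : Set C(L, ℂ)) := y.2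
  obtain ⟨b, hb, hd⟩ := Metric.mem_closure_iff.mp hycl ε hε
  obtain ⟨p, -, rfl⟩ := hb
  refine ⟨p, fun z hz => ?_⟩
  have h3 := (ContinuousMap.dist_lt_iff hε).mp hd ⟨z, hz⟩
  rw [hyv, dist_comm, dist_eq_norm] at h3
  exact h3

/-- The complement of a closed disc together with a proper closed part of the unit circle is
connected. -/
theorem isPreconnected_compl_closedBall_union {r : ℝ} (hr1 : r < 1) {K : Set ℂ}
    (hK : K ⊆ Metric.sphere 0 1) (hne : K ≠ Metric.sphere 0 1) :
    IsPreconnected (Metric.closedBall 0 r ∪ K)ᶜ := by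
  obtain ⟨ζ, hζ, hζK⟩ : ∃ ζ ∈ Metric.sphere (0 : ℂ) 1, ζ ∉ K := by
    by_contra! h
    exact hne (hK.antisymm h)
  -- An annulus is a polar-coordinate image of a rectangle, and adding a point of its closure keeps
  -- it connected.
  have key : ∀ I : Set ℝ, I.OrdConnected → I ⊆ Set.Ici 0 → 1 ∈ closure I → ∀ w : ℂ, ‖w‖ = 1 →
      IsPreconnected (insert w {z : ℂ | ‖z‖ ∈ I} : Set ℂ) := by
    intro I hI hI0 hI1 w hw
    have h : {z : ℂ | ‖z‖ ∈ I} =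
        (fun p : ℝ × ℝ => (p.1 : ℂ) * Complex.exp (p.2 * Complex.I)) '' (I ×ˢ Set.univ) := by
      ext z
      constructor
      · intro hz
        exact ⟨(‖z‖, z.arg), ⟨hz, trivial⟩, Complex.norm_mul_exp_arg_mul_I z⟩
      · rintro ⟨⟨t, θ⟩, ⟨ht, -⟩, rfl⟩
        have : |t| = t := abs_of_nonneg (hI0 ht)
        simpa [Complex.norm_exp_ofReal_mul_I, this] using ht
    have hcon : IsPreconnected {z : ℂ | ‖z‖ ∈ I} := by
      rw [h]
      refine (hI.isPreconnected.prod isPreconnected_univ).image _ (Continuous.continuousOn ?_)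
      fun_prop
    have hw' : ((1 : ℝ) : ℂ) * w ∈ closure {z : ℂ | ‖z‖ ∈ I} := by
      refine map_mem_closure (f := fun t : ℝ => (t : ℂ) * w) (by fun_prop) hI1 fun t ht => ?_
      have : |t| = t := abs_of_nonneg (hI0 ht)
      simpa [hw, this] using ht
    rw [Complex.ofReal_one, one_mul] at hw'
    exact hcon.subset_closure (Set.subset_insert _ _) (Set.insert_subset hw' subset_closure)
  have hr0 : max r 0 < 1 := max_lt hr1 one_pos
  have hin : ∀ w : ℂ, ‖w‖ = 1 → IsPreconnected (insert w {z : ℂ | ‖z‖ ∈ Set.Ico 0 1 ∩ Set.Ioi r}) := by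
    refine key _ (Set.ordConnected_Ico.inter Set.ordConnected_Ioi) (fun t ht => ht.1.1) ?_
    have hsub : Set.Ioo (max r 0) 1 ⊆ Set.Ico 0 1 ∩ Set.Ioi r := fun t ht =>
      ⟨⟨(le_max_right r 0).trans ht.1.le, ht.2⟩, (le_max_left r 0).trans_lt ht.1⟩
    refine closure_mono hsub ?_
    rw [closure_Ioo hr0.ne]
    exact Set.right_mem_Icc.mpr hr0.le
  have hout : ∀ w : ℂ, ‖w‖ = 1 → IsPreconnected (insert w {z : ℂ | ‖z‖ ∈ Set.Ioi 1}) :=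
    key _ Set.ordConnected_Ioi (fun t ht => zero_le_one.trans (Set.mem_Ioi.mp ht).le)
      (by rw [closure_Ioi]; exact Set.self_mem_Ici)
  obtain ⟨t, hrt, ht1⟩ := exists_between hr0
  have ht0 : 0 ≤ t := (le_max_right r 0).trans hrt.le
  -- Each point `w` of the circle off `K` is a bridge between the inner annulus and the exterior;
  -- all these pieces share the point `t`.
  have heq : (Metric.closedBall 0 r ∪ K)ᶜ = ⋃ w : ↥(Metric.sphere (0 : ℂ) 1 \ K),
      (insert (w : ℂ) {z : ℂ | ‖z‖ ∈ Set.Ico 0 1 ∩ Set.Ioi r} ∪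
        insert (w : ℂ) {z : ℂ | ‖z‖ ∈ Set.Ioi 1}) := by
    ext z
    simp only [Set.mem_compl_iff, Set.mem_union, mem_closedBall_zero_iff, not_or, not_le,
      Set.mem_iUnion, Set.mem_insert_iff]
    constructor
    · rintro ⟨hz, hzK⟩
      rcases lt_trichotomy ‖z‖ 1 with h | h | h
      · exact ⟨⟨ζ, hζ, hζK⟩, Or.inl (Or.inr ⟨⟨norm_nonneg _, h⟩, hz⟩)⟩
      · exact ⟨⟨z, by simpa using h, hzK⟩, Or.inl (Or.inl rfl)⟩
      · exact ⟨⟨ζ, hζ, hζK⟩, Or.inr (Or.inr h)⟩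
    · rintro ⟨⟨w, hw, hwK⟩, h⟩
      have hnK : ‖z‖ ≠ 1 → z ∉ K := fun h hz => h (by simpa using hK hz)
      have hw1 : ‖w‖ = 1 := by simpa using hw
      rcases h with (rfl | h) | (rfl | h)
      · exact ⟨hr1.trans_eq hw1.symm, hwK⟩
      · exact ⟨h.2, hnK h.1.2.ne⟩
      · exact ⟨hr1.trans_eq hw1.symm, hwK⟩
      · exact ⟨hr1.trans h, hnK (ne_of_gt h)⟩
  rw [heq]
  refine isPreconnected_iUnion (Set.nonempty_of_mem (x := (t : ℂ)) ?_) fun w => ?_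
  · refine Set.mem_iInter.mpr fun w => Or.inl (Or.inr ?_)
    have : ‖(t : ℂ)‖ = t := by simp [ht0]
    change ‖(t : ℂ)‖ ∈ Set.Ico 0 1 ∩ Set.Ioi r
    rw [this]
    exact ⟨⟨ht0, ht1⟩, (le_max_left r 0).trans_lt hrt⟩
  · have hw1 : ‖(w : ℂ)‖ = 1 := by simpa using w.2.1
    exact (hin w hw1).union (w : ℂ) (Set.mem_insert _ _) (Set.mem_insert _ _) (hout w hw1)

open Polynomial in
/-- Every continuous function on a proper closed part of the unit circle is a uniform limit of
polynomials. -/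
theorem exists_polynomial_near_continuousOn {K : Set ℂ} (hKc : IsCompact K)
    (hK : K ⊆ Metric.sphere 0 1) (hne : K ≠ Metric.sphere 0 1) {φ : ℂ → ℂ}
    (hφ : ContinuousOn φ K) {ε : ℝ} (hε : 0 < ε) :
    ∃ p : ℂ[X], ∀ z ∈ K, ‖p.eval z - φ z‖ < ε := by
  have hc : IsPreconnected Kᶜ := by
    have := isPreconnected_compl_closedBall_union (r := -1) (by norm_num) hK hne
    rwa [Metric.closedBall_eq_empty.mpr (by norm_num), Set.empty_union] at this
  have hK1 : ∀ z ∈ K, ‖z‖ = 1 := fun z hz => by simpa using hK hz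
  have : CompactSpace K := isCompact_iff_compactSpace.mp hKc
  let S : Subalgebra ℂ C(K, ℂ) := (polynomialFunctions K).topologicalClosure
  have hS : IsClosed (S : Set C(K, ℂ)) := Subalgebra.isClosed_topologicalClosure _
  have hX : (X : ℂ[X]).toContinuousMapOn K ∈ S :=
    Subalgebra.le_topologicalClosure _ ⟨X, trivial, rfl⟩
  -- On the circle the conjugate of `z` is `1/z`, a limit of polynomials on `K`; Stone–Weierstrass
  -- then applies.
  have hstar : star ((X : ℂ[X]).toContinuousMapOn K) ∈ S := by
    refine Metric.mem_closure_iff.mpr fun δ hδ => ?_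
    obtain ⟨p, hp⟩ := exists_polynomial_near_inv hKc hc X
      (fun z hz => by rw [eval_X, ← norm_ne_zero_iff, hK1 z hz]; exact one_ne_zero) hδ
    refine ⟨p.toContinuousMapOn K, ⟨p, trivial, rfl⟩, (ContinuousMap.dist_lt_iff hδ).mpr ?_⟩
    intro z
    have h := hp z z.2
    rw [eval_X, Complex.inv_eq_conj (hK1 z z.2)] at h
    rw [dist_comm, dist_eq_norm]
    simpa using h
  have htop : (polynomialFunctions K).starClosure.topologicalClosure = ⊤ :=
    polynomialFunctions.starClosure_topologicalClosure K
  have hle : ((polynomialFunctions K).starClosure : Set C(K, ℂ)) ⊆ S := by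
    have h : (polynomialFunctions K).starClosure.toSubalgebra ≤ S := by
      rw [polynomialFunctions.starClosure_eq_adjoin_X, StarAlgebra.adjoin_toSubalgebra]
      refine Algebra.adjoin_le ?_
      rw [Set.star_singleton]
      rintro f (rfl | rfl)
      exacts [hX, hstar]
    exact h
  have hmem : (⟨K.domRestrict φ, hφ.domRestrict⟩ : C(K, ℂ)) ∈ S := by
    have h : (⟨K.domRestrict φ, hφ.domRestrict⟩ : C(K, ℂ)) ∈
        closure ((polynomialFunctions K).starClosure : Set C(K, ℂ)) := by
      rw [← StarSubalgebra.topologicalClosure_coe, htop]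
      trivial
    exact closure_minimal hle hS h
  obtain ⟨b, ⟨p, -, rfl⟩, hd⟩ := Metric.mem_closure_iff.mp hmem ε hε
  refine ⟨p, fun z hz => ?_⟩
  have h3 := (ContinuousMap.dist_lt_iff hε).mp hd ⟨z, hz⟩
  rw [dist_comm, dist_eq_norm] at h3
  exact h3

open Polynomial in
/-- A polynomial without constant term separating a smaller disc from a proper closed part of the
unit circle. -/
theorem exists_polynomial_separating {K : Set ℂ} (hKc : IsCompact K)
    (hK : K ⊆ Metric.sphere 0 1) (hne : K ≠ Metric.sphere 0 1) {r : ℝ} (hr0 : 0 < r)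
    (hr1 : r < 1) {δ : ℝ} (hδ : 0 < δ) :
    ∃ g : ℂ[X], X ∣ g ∧ (∀ z, ‖z‖ ≤ r → ‖g.eval z‖ ≤ δ) ∧ ∀ z ∈ K, ‖1 - g.eval z‖ ≤ δ := by
  have hK1 : ∀ z ∈ K, ‖z‖ = 1 := fun z hz => by simpa using hK hz
  -- The model is `z^n / (z^n - y)` with `y = ρ^n`, whose poles lie on `|z| = ρ`, between `r` and
  -- `1`. On the disc `|z^n| ≤ y²`, so it is at most `2y`; on `K` it differs from `1` by at most
  -- `2y`.
  set ρ : ℝ := √r with hρ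
  have hρ0 : 0 < ρ := Real.sqrt_pos.mpr hr0
  have hρ1 : ρ < 1 := by rw [hρ, Real.sqrt_lt' one_pos]; simpa using hr1
  have hρr : r = ρ * ρ := (Real.mul_self_sqrt hr0.le).symm
  set η : ℝ := min (δ / 4) (1 / 2) with hη
  have hη0 : 0 < η := by positivity
  obtain ⟨n, hn⟩ := exists_pow_lt_of_lt_one hη0 hρ1
  have hn0 : n ≠ 0 := by
    rintro rfl
    have : η ≤ 1 / 2 := min_le_right _ _
    norm_num at hn
    linarith
  set y : ℝ := ρ ^ n with hy
  have hy0 : 0 < y := by positivity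
  have hyδ : y < δ / 4 := hn.trans_le (min_le_left _ _)
  have hy2 : y < 1 / 2 := hn.trans_le (min_le_right _ _)
  have hin : ∀ z : ℂ, ‖z‖ ≤ r → ‖z ^ n‖ ≤ y * y := by
    intro z hz
    rw [norm_pow, hy, ← mul_pow, ← hρr]
    exact pow_le_pow_left₀ (norm_nonneg z) hz n
  have hyn : ‖((y : ℝ) : ℂ)‖ = y := by simp [hy0.le]
  have hlow_in : ∀ z : ℂ, ‖z‖ ≤ r → y / 2 ≤ ‖z ^ n - y‖ := by
    intro z hz
    have h1 := norm_sub_norm_le (y : ℂ) (z ^ n)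
    rw [norm_sub_rev, hyn] at h1
    have := hin z hz
    nlinarith
  have hlow_K : ∀ z ∈ K, 1 / 2 ≤ ‖z ^ n - y‖ := by
    intro z hz
    have h1 := norm_sub_norm_le (z ^ n) (y : ℂ)
    rw [norm_pow, hK1 z hz, one_pow, hyn] at h1
    linarith
  obtain ⟨p, hp⟩ := exists_polynomial_near_inv ((isCompact_closedBall (0 : ℂ) r).union hKc)
    (isPreconnected_compl_closedBall_union hr1 hK hne) (X ^ n - C (y : ℂ)) (by
      intro z hz h0
      rw [eval_sub, eval_pow, eval_X, eval_C] at h0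
      rcases hz with hz | hz
      · have := hlow_in z (by simpa using hz)
        rw [h0, norm_zero] at this
        linarith
      · have := hlow_K z hz
        rw [h0, norm_zero] at this
        linarith) (half_pos hδ)
  simp only [eval_sub, eval_pow, eval_X, eval_C] at hp
  refine ⟨X ^ n * p, Dvd.dvd.mul_right (dvd_pow_self X hn0) p, fun z hz => ?_, fun z hz => ?_⟩
  · have h1 := hp z (Or.inl (by simpa using hz))
    have h2 := hin z hz
    have h3 := hlow_in z hz
    have h4 : ‖(z ^ n - (y : ℂ))⁻¹‖ ≤ (y / 2)⁻¹ := by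
      rw [norm_inv]
      exact inv_anti₀ (by positivity) h3
    have h5 : eval z (X ^ n * p) = z ^ n * (eval z p - (z ^ n - (y : ℂ))⁻¹) +
        z ^ n * (z ^ n - (y : ℂ))⁻¹ := by
      simp only [eval_mul, eval_pow, eval_X]; ring
    rw [h5]
    refine (norm_add_le _ _).trans ?_
    rw [norm_mul, norm_mul (z ^ n) (z ^ n - (y : ℂ))⁻¹]
    have h6 : ‖z ^ n‖ * ‖eval z p - (z ^ n - (y : ℂ))⁻¹‖ ≤ 1 * (δ / 2) :=
      mul_le_mul (h2.trans (by nlinarith)) h1.le (norm_nonneg _) zero_le_one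
    have h7 : ‖z ^ n‖ * ‖(z ^ n - (y : ℂ))⁻¹‖ ≤ (y * y) * (y / 2)⁻¹ :=
      mul_le_mul h2 h4 (norm_nonneg _) (by positivity)
    have h8 : (y * y) * (y / 2)⁻¹ = 2 * y := by field_simp
    linarith
  · have h1 := hp z (Or.inr hz)
    have h3 := hlow_K z hz
    have hz1 : ‖z ^ n‖ = 1 := by rw [norm_pow, hK1 z hz, one_pow]
    have h0 : z ^ n - (y : ℂ) ≠ 0 := by
      rw [← norm_pos_iff]; linarith
    have h5 : 1 - eval z (X ^ n * p) = -(z ^ n * (eval z p - (z ^ n - (y : ℂ))⁻¹)) -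
        y * (z ^ n - (y : ℂ))⁻¹ := by
      simp only [eval_mul, eval_pow, eval_X]
      field_simp
      ring
    rw [h5]
    refine (norm_sub_le _ _).trans ?_
    rw [norm_neg, norm_mul, norm_mul (y : ℂ), hz1, one_mul, hyn, norm_inv]
    have h4 : ‖z ^ n - (y : ℂ)‖⁻¹ ≤ (1 / 2)⁻¹ := inv_anti₀ (by positivity) h3
    have h7 : y * ‖z ^ n - (y : ℂ)‖⁻¹ ≤ y * (1 / 2)⁻¹ := mul_le_mul_of_nonneg_left h4 hy0.le
    norm_num at h7
    linarith

/-! ### Sharpening polynomials and the translation argument -/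

open Polynomial in
/-- The upper half of the binomial expansion of `(x + (1 - x)) ^ (2 * N)` is a polynomial divisible
by `X ^ N` which is close to `0` near `0` and close to `1` near `1`. -/
theorem exists_polynomial_sharpening (N : ℕ) :
    ∃ B : ℂ[X], X ^ N ∣ B ∧ B.natDegree ≤ 2 * N ∧
      (∀ x : ℂ, ‖x‖ ≤ 1 / 16 → ‖B.eval x‖ ≤ (1 / 2) ^ N) ∧
      ∀ x : ℂ, ‖1 - x‖ ≤ 1 / 16 → ‖1 - B.eval x‖ ≤ (1 / 2) ^ N := by
  let b : ℕ → ℂ[X] := fun k => X ^ k * (1 - X) ^ (2 * N - k) * ((2 * N).choose k : ℂ[X])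
  have hsum : ∑ k ∈ Finset.range (2 * N + 1), b k = 1 := by
    rw [← add_pow, add_sub_cancel, one_pow]
  have hsplit : ∑ k ∈ Finset.range N, b k + ∑ k ∈ Finset.Ico N (2 * N + 1), b k = 1 := by
    rw [← hsum]
    exact Finset.sum_range_add_sum_Ico _ (by omega)
  have hchoose : ∀ s ⊆ Finset.range (2 * N + 1), ∑ k ∈ s, ((2 * N).choose k : ℝ) ≤ 4 ^ N := by
    intro s hs
    have h : ∑ k ∈ Finset.range (2 * N + 1), ((2 * N).choose k : ℝ) = 4 ^ N := by
      have := Nat.sum_range_choose (2 * N)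
      rw [pow_mul] at this
      exact_mod_cast this
    rw [← h]
    exact Finset.sum_le_sum_of_subset_of_nonneg hs fun _ _ _ => Nat.cast_nonneg _
  have hbound : ∀ (u v : ℂ), ‖u‖ ≤ 1 / 16 → ‖v‖ ≤ 2 → ∀ i j : ℕ, N ≤ i → i + j = 2 * N →
      ‖u‖ ^ i * ‖v‖ ^ j ≤ (1 / 8) ^ N := by
    intro u v hu hv i j hi hij
    calc ‖u‖ ^ i * ‖v‖ ^ j ≤ (1 / 16) ^ i * 2 ^ j := by gcongr
      _ ≤ (1 / 16) ^ N * 2 ^ N := by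
        gcongr ?_ * ?_
        · exact pow_le_pow_of_le_one (by norm_num) (by norm_num) hi
        · exact pow_le_pow_right₀ (by norm_num) (by omega)
      _ = (1 / 8) ^ N := by rw [← mul_pow]; norm_num
  -- The binomial coefficients sum to at most `4^N`, against `(1/8)^N` for each power product: this
  -- is why the radius `1/16` suffices.
  have hest : ∀ s ⊆ Finset.range (2 * N + 1), ∀ x : ℂ,
      (∀ k ∈ s, ‖x‖ ^ k * ‖1 - x‖ ^ (2 * N - k) ≤ (1 / 8) ^ N) →
      ‖(∑ k ∈ s, b k).eval x‖ ≤ (1 / 2) ^ N := by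
    intro s hs x hx
    rw [eval_finsetSum]
    calc ‖∑ k ∈ s, (b k).eval x‖ ≤ ∑ k ∈ s, (1 / 8) ^ N * ((2 * N).choose k : ℝ) := by
          refine norm_sum_le_of_le _ fun k hk => ?_
          simp only [b, eval_mul, eval_pow, eval_X, eval_sub, eval_one, eval_natCast, norm_mul,
            norm_pow, Complex.norm_natCast]
          exact mul_le_mul_of_nonneg_right (hx k hk) (Nat.cast_nonneg _)
      _ ≤ (1 / 8) ^ N * 4 ^ N := by
          rw [← Finset.mul_sum]
          exact mul_le_mul_of_nonneg_left (hchoose s hs) (by positivity)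
      _ = (1 / 2) ^ N := by rw [← mul_pow]; norm_num
  have hnorm : ∀ x y : ℂ, ‖y‖ ≤ 1 / 16 → x = 1 - y → ‖x‖ ≤ 2 := by
    rintro x y hy rfl
    refine (norm_sub_le _ _).trans ?_
    rw [norm_one]
    linarith
  refine ⟨∑ k ∈ Finset.Ico N (2 * N + 1), b k, ?_, ?_, fun x hx => ?_, fun x hx => ?_⟩
  · refine Finset.dvd_sum fun k hk => ?_
    simp only [b]
    rw [mul_assoc]
    exact (pow_dvd_pow X (Finset.mem_Ico.mp hk).1).mul_right _
  · refine natDegree_sum_le_of_forall_le _ _ fun k hk => ?_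
    have hk' := Finset.mem_Ico.mp hk
    have h1 : (1 - X : ℂ[X]).natDegree ≤ 1 := by
      refine (natDegree_sub_le _ _).trans ?_
      simp
    refine natDegree_mul_le.trans ?_
    rw [natDegree_natCast, add_zero]
    refine natDegree_mul_le.trans ?_
    rw [natDegree_X_pow]
    have h2 := natDegree_pow_le_of_le (2 * N - k) h1
    omega
  · refine hest _ (fun k hk => ?_) x fun k hk => ?_
    · exact Finset.mem_range.mpr (Finset.mem_Ico.mp hk).2
    · have hk' := Finset.mem_Ico.mp hk
      exact hbound _ _ hx (hnorm _ x hx rfl) _ _ hk'.1 (by omega)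
  · have h : (1 : ℂ) - (∑ k ∈ Finset.Ico N (2 * N + 1), b k).eval x =
        (∑ k ∈ Finset.range N, b k).eval x := by
      rw [sub_eq_iff_eq_add, ← eval_add, hsplit, eval_one]
    rw [h]
    refine hest _ (Finset.range_subset_range.mpr (by omega)) x fun k hk => ?_
    have hk' := Finset.mem_range.mp hk
    rw [mul_comm]
    exact hbound _ _ hx (hnorm _ _ hx (by ring)) _ _ (by omega) (by omega)

/-- Finitely many points can be moved out of the open unit disc by a common translation whose
length is of the order of the square root of the number of points. -/
theorem exists_translation_one_le_norm (A : ℕ → ℂ) {D m : ℕ} (hm : D < m * m) :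
    ∃ v : ℂ, ‖v‖ ≤ 4 * m ∧ ∀ n < D, 1 ≤ ‖A n + v‖ := by
  by_contra! h
  -- Grid of `m²` points with spacing `2`. If every translation failed, two grid points would serve
  -- the same index and lie at distance less than `2`.
  let p : ℕ × ℕ → ℂ := fun a => 2 * a.1 + 2 * a.2 * Complex.I
  have hp : ∀ a ∈ Finset.range m ×ˢ Finset.range m, ∃ n < D, ‖A n + p a‖ < 1 := by
    intro a ha
    rw [Finset.mem_product, Finset.mem_range, Finset.mem_range] at ha
    refine h (p a) ((norm_add_le _ _).trans ?_)
    have h1 : (a.1 : ℝ) ≤ m := by exact_mod_cast ha.1.le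
    have h2 : (a.2 : ℝ) ≤ m := by exact_mod_cast ha.2.le
    simp only [norm_mul, Complex.norm_natCast, Complex.norm_I, Complex.norm_ofNat]
    linarith
  choose! n hn hlt using hp
  obtain ⟨a, ha, b, hb, hab, heq⟩ := Finset.exists_ne_map_eq_of_card_lt_of_maps_to
    (s := Finset.range m ×ˢ Finset.range m) (t := Finset.range D) (by simpa using hm) (f := n)
    (fun a ha => Finset.mem_range.mpr (hn a ha))
  have hd : ‖p a - p b‖ < 2 := by
    have h1 := hlt a ha
    have h2 := hlt b hb
    rw [heq] at h1
    have h3 := norm_sub_le (A (n b) + p a) (A (n b) + p b)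
    rw [add_sub_add_left_eq_sub] at h3
    linarith
  have hre := (Complex.abs_re_le_norm _).trans_lt hd
  have him := (Complex.abs_im_le_norm _).trans_lt hd
  have hre' : (p a - p b).re = 2 * (((a.1 : ℤ) - b.1 : ℤ) : ℝ) := by
    simp [p]; ring
  have him' : (p a - p b).im = 2 * (((a.2 : ℤ) - b.2 : ℤ) : ℝ) := by
    simp [p]; ring
  have hint : ∀ i : ℤ, |2 * (i : ℝ)| < 2 → i = 0 := by
    intro i hi
    rw [abs_mul, abs_two] at hi
    have : |(i : ℝ)| < 1 := by linarith
    exact Int.abs_lt_one_iff.mp (by exact_mod_cast this)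
  rw [hre'] at hre
  rw [him'] at him
  have e1 := hint _ hre
  have e2 := hint _ him
  exact hab (Prod.ext (by omega) (by omega))

/-- This growth of the weights lets a small coefficient cause a large translation; for `l = 0` the
weight would be `1`. -/
theorem Nat.le_descFactorial_self {l n : ℕ} (hl : 1 ≤ l) (hn : l ≤ n) : n ≤ n.descFactorial l := by
  induction l, hl using Nat.le_induction with
  | base => simp
  | succ k hk ih =>
    rw [Nat.descFactorial_succ]
    exact (ih (by omega)).trans (Nat.le_mul_of_pos_left _ (by omega))

/-! ### The inductive step -/

open Polynomial in
/-- A polynomial `Q` can be modified in high degrees, by a small amount on a disc, so as to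
approximate a given function on a proper closed part `K` of the unit circle, while the partial sums
of the `l`-th derivative at `1` stay outside the unit disc. -/
theorem exists_polynomial_approx_of_one_le_norm {l : ℕ} (hl : 1 ≤ l) {n₀ : ℕ} {Q : ℂ[X]}
    (hQ : ∀ n ≥ n₀, 1 ≤ ‖∑ k ∈ Finset.range n, (k.descFactorial l : ℂ) * Q.coeff k‖) (M : ℕ)
    {K : Set ℂ} (hKc : IsCompact K) (hK : K ⊆ Metric.sphere 0 1) (hne : K ≠ Metric.sphere 0 1)
    {φ : ℂ → ℂ} (hφ : ContinuousOn φ K) {r : ℝ} (hr0 : 0 < r) (hr1 : r < 1) {ε : ℝ} (hε : 0 < ε) :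
    ∃ R : ℂ[X], (∀ k < M, R.coeff k = Q.coeff k) ∧
      (∀ z, ‖z‖ ≤ r → ‖R.eval z - Q.eval z‖ ≤ ε) ∧ (∀ z ∈ K, ‖R.eval z - φ z‖ ≤ ε) ∧
      ∀ n ≥ n₀, 1 ≤ ‖∑ k ∈ Finset.range n, (k.descFactorial l : ℂ) * R.coeff k‖ := by
  have hK1 : ∀ z ∈ K, ‖z‖ = 1 := fun z hz => by simpa using hK hz
  have hε3 : 0 < ε / 3 := by positivity
  obtain ⟨ψ, hψ⟩ := exists_polynomial_near_continuousOn hKc hK hne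
    (φ := fun z => φ z - Q.eval z) (hφ.sub Q.continuous.continuousOn) hε3
  obtain ⟨g, hgX, hgr, hgK⟩ := exists_polynomial_separating hKc hK hne hr0 hr1
    (δ := 1 / 16) (by norm_num)
  obtain ⟨C₀, hC₀⟩ := (isCompact_closedBall (0 : ℂ) 1).exists_bound_of_continuousOn
    ψ.continuous.continuousOn
  have hC0 : 0 ≤ C₀ := (norm_nonneg _).trans (hC₀ 0 (by simp))
  set q := 2 * g.natDegree with hq
  set e := Q.natDegree + ψ.natDegree + 1 with he
  -- Chosen so that `(c * t)²` exceeds the number `D + 1` of partial sums to be moved.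
  set c := 2 * q + e + 2 with hc
  have hlim₁ : ∀ᶠ t : ℕ in atTop, 4 * (c : ℝ) / t < ε / 3 :=
    (tendsto_const_div_atTop_nhds_zero_nat (4 * (c : ℝ))).eventually_lt_const hε3
  have hlim₂ : ∀ᶠ t : ℕ in atTop, C₀ * (1 / 2 : ℝ) ^ t < ε / 3 := by
    have h := (tendsto_pow_atTop_nhds_zero_of_lt_one (r := (1 / 2 : ℝ)) (by norm_num)
      (by norm_num)).const_mul C₀
    rw [mul_zero] at h
    exact h.eventually_lt_const hε3
  obtain ⟨t, ht₁, ht₂, ht1, htl, htM⟩ := (hlim₁.and <| hlim₂.and <|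
    (eventually_ge_atTop 1).and <| (eventually_ge_atTop l).and (eventually_ge_atTop M)).exists
  have htt : t ≤ t * t := Nat.le_mul_self t
  -- The exponent `t² + 1` leaves the coefficient of degree `t²` free for `a`.
  obtain ⟨B, hBX, hBd, hB0, hB1⟩ := exists_polynomial_sharpening (t * t + 1)
  have hpow : (1 / 2 : ℝ) ^ (t * t + 1) ≤ (1 / 2) ^ t :=
    pow_le_pow_of_le_one (by norm_num) (by norm_num) (by omega)
  set F := ψ * B.comp g with hF
  have hFX : X ^ (t * t + 1) ∣ F := by
    refine Dvd.dvd.mul_left ?_ ψ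
    obtain ⟨B', rfl⟩ := hBX
    rw [mul_comp, X_pow_comp]
    exact (pow_dvd_pow_of_dvd hgX _).mul_right _
  have hFd : F.natDegree ≤ ψ.natDegree + q * (t * t + 1) := by
    refine natDegree_mul_le.trans (Nat.add_le_add_left ?_ _)
    rw [natDegree_comp]
    calc B.natDegree * g.natDegree ≤ 2 * (t * t + 1) * g.natDegree :=
          Nat.mul_le_mul_right _ hBd
      _ = q * (t * t + 1) := by rw [hq]; ring
  let A : ℕ → ℂ := fun n => ∑ k ∈ Finset.range n,
    (k.descFactorial l : ℂ) * (Q.coeff k + F.coeff k)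
  set D := e + q * (t * t + 1) with hD
  have hA : ∀ n, D ≤ n → A n = A D := by
    intro n hn
    refine (Finset.sum_subset (Finset.range_subset_range.mpr hn) fun k _ hk => ?_).symm
    rw [Finset.mem_range, not_lt] at hk
    rw [coeff_eq_zero_of_natDegree_lt (p := Q) (by omega),
      coeff_eq_zero_of_natDegree_lt (p := F) (by omega), add_zero, mul_zero]
  have hm : D + 1 < (c * t) * (c * t) := by
    have h1 : 1 ≤ t * t := ht1.trans htt
    have h2 : (c * t) * (c * t) = c * c * (t * t) := by ring
    have h3 : c * (t * t) ≤ c * c * (t * t) := Nat.mul_le_mul_right _ (Nat.le_mul_self c)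
    rw [h2]
    refine lt_of_lt_of_le ?_ h3
    rw [hD, hc]
    nlinarith
  obtain ⟨v, hv, hvA⟩ := exists_translation_one_le_norm A hm
  have hvA' : ∀ n, 1 ≤ ‖A n + v‖ := by
    intro n
    rcases le_total D n with h | h
    · rw [hA n h]
      exact hvA D (by omega)
    · exact hvA n (by omega)
  set w : ℕ := (t * t).descFactorial l with hw
  have hwt : t * t ≤ w := Nat.le_descFactorial_self hl (htl.trans htt)
  have hw0 : (w : ℂ) ≠ 0 := by
    have : 0 < w := by omega
    exact_mod_cast this.ne'
  set a : ℂ := v / w with ha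
  have hanorm : ‖a‖ < ε / 3 := by
    refine lt_of_le_of_lt ?_ ht₁
    have ht0 : (0 : ℝ) < t := by exact_mod_cast ht1
    have hwt' : (t : ℝ) * t ≤ w := by exact_mod_cast hwt
    rw [ha, norm_div, Complex.norm_natCast]
    calc ‖v‖ / w ≤ (4 * ((c * t : ℕ) : ℝ)) / (t * t) := by gcongr
      _ = 4 * c / t := by push_cast; field_simp
  have haz : ∀ z : ℂ, ‖z‖ ≤ 1 → ‖a * z ^ (t * t)‖ ≤ ε / 3 := by
    intro z hz
    rw [norm_mul, norm_pow]
    exact (mul_le_of_le_one_right (norm_nonneg _) (pow_le_one₀ (norm_nonneg _) hz)).trans hanorm.le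
  have hsmall : ∀ z : ℂ, ‖z‖ ≤ 1 → ∀ y : ℂ, ‖y‖ ≤ (1 / 2) ^ (t * t + 1) →
      ‖ψ.eval z * y‖ ≤ ε / 3 := by
    intro z hz y hy
    rw [norm_mul]
    exact (mul_le_mul (hC₀ z (by simpa using hz)) (hy.trans hpow) (norm_nonneg _) hC0).trans ht₂.le
  have hcoeff : ∀ k, (Q + (C a * X ^ (t * t) + F)).coeff k =
      Q.coeff k + F.coeff k + if k = t * t then a else 0 := by
    intro k
    rw [coeff_add, coeff_add, coeff_C_mul_X_pow]
    ring
  have hlow : ∀ k < t * t, (Q + (C a * X ^ (t * t) + F)).coeff k = Q.coeff k := by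
    intro k hk
    rw [hcoeff, if_neg hk.ne, X_pow_dvd_iff.mp hFX k (by omega), add_zero, add_zero]
  have heval : ∀ z, (Q + (C a * X ^ (t * t) + F)).eval z =
      Q.eval z + (a * z ^ (t * t) + ψ.eval z * B.eval (g.eval z)) := by
    intro z
    simp [hF]
  refine ⟨Q + (C a * X ^ (t * t) + F), fun k hk => hlow k (by omega), fun z hz => ?_,
    fun z hz => ?_, fun n hn => ?_⟩
  · have hz1 : ‖z‖ ≤ 1 := hz.trans hr1.le
    rw [heval, add_sub_cancel_left]
    refine (norm_add_le _ _).trans ?_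
    have h1 := haz z hz1
    have h2 := hsmall z hz1 _ (hB0 _ (hgr z hz))
    linarith
  · have hz1 : ‖z‖ ≤ 1 := (hK1 z hz).le
    have h : (Q + (C a * X ^ (t * t) + F)).eval z - φ z = (ψ.eval z - (φ z - Q.eval z)) +
        a * z ^ (t * t) - ψ.eval z * (1 - B.eval (g.eval z)) := by
      rw [heval]; ring
    rw [h]
    refine (norm_sub_le _ _).trans ((add_le_add_left (norm_add_le _ _) _).trans ?_)
    have h1 := haz z hz1
    have h2 := hsmall z hz1 _ (hB1 _ (hgK z hz))
    have h3 := hψ z hz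
    linarith
  -- Up to `t²` the sums are those of `Q`; beyond it they are the translated `A n + v`.
  · rcases le_or_gt n (t * t) with h | h
    · rw [Finset.sum_congr rfl fun k hk => by
        rw [hlow k ((Finset.mem_range.mp hk).trans_le h)]]
      exact hQ n hn
    · have hsum : ∑ k ∈ Finset.range n,
          (k.descFactorial l : ℂ) * (Q + (C a * X ^ (t * t) + F)).coeff k = A n + v := by
        have hv' : v = (w : ℂ) * a := by rw [ha, mul_div_cancel₀ _ hw0]
        simp only [hcoeff, mul_add _ (_ + _), mul_ite, mul_zero]
        rw [Finset.sum_add_distrib, Finset.sum_ite_eq', if_pos (Finset.mem_range.mpr h), hv']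
      rw [hsum]
      exact hvA' n

/-! ### Countably many targets -/

/-- A sequence of approximation problems on proper compact parts of the unit circle which comes
infinitely often arbitrarily close to any such problem. -/
theorem exists_seq_approximation_problems :
    ∃ (K : ℕ → Set ℂ) (φ : ℕ → C(ℂ, ℂ)),
      (∀ j, IsCompact (K j) ∧ K j ⊆ Metric.sphere 0 1 ∧ K j ≠ Metric.sphere 0 1) ∧
      ∀ K' : Set ℂ, IsCompact K' → K' ⊆ Metric.sphere 0 1 → K' ≠ Metric.sphere 0 1 →
        ∀ φ' : ℂ → ℂ, ContinuousOn φ' K' → ∀ ε > 0,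
          ∃ᶠ j in atTop, K' ⊆ K j ∧ ∀ z ∈ K', ‖φ j z - φ' z‖ < ε := by
  have : Nonempty (Metric.sphere (0 : ℂ) 1) := ⟨⟨1, by simp⟩⟩
  let x : ℕ → Metric.sphere (0 : ℂ) 1 := TopologicalSpace.denseSeq _
  -- Decoding only the first component of `j.unpair` makes every triple (centre, radius, function)
  -- recur infinitely often.
  let T : ℕ → ℕ × ℕ × ℕ := fun j => Denumerable.ofNat _ j.unpair.1
  refine ⟨fun j => Metric.sphere 0 1 \ Metric.ball (x (T j).1 : ℂ) (1 / ((T j).2.1 + 1)),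
    fun j => TopologicalSpace.denseSeq C(ℂ, ℂ) (T j).2.2, fun j => ⟨?_, ?_, ?_⟩, ?_⟩
  · exact (isCompact_sphere _ _).diff Metric.isOpen_ball
  · exact Set.sdiff_subset
  · intro h
    exact (h.ge (x (T j).1).2).2 (Metric.mem_ball_self (by positivity))
  · intro K' hK'c hK' hne φ' hφ' ε hε
    obtain ⟨ζ, hζ, hζK⟩ : ∃ ζ ∈ Metric.sphere (0 : ℂ) 1, ζ ∉ K' := by
      by_contra! h
      exact hne (hK'.antisymm h)
    obtain ⟨δ, hδ, hball⟩ := Metric.isOpen_iff.mp hK'c.isClosed.isOpen_compl ζ hζK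
    obtain ⟨m, hm⟩ := exists_nat_one_div_lt (half_pos hδ)
    obtain ⟨i, hi⟩ := (TopologicalSpace.denseRange_denseSeq (Metric.sphere (0 : ℂ) 1)).exists_dist_lt
      ⟨ζ, hζ⟩ (half_pos hδ)
    have hsub : K' ⊆ Metric.sphere 0 1 \ Metric.ball (x i : ℂ) (1 / (m + 1)) := by
      refine fun z hz => ⟨hK' hz, fun hzb => hball ?_ hz⟩
      have h1 : dist z (x i) < δ / 2 := (Metric.mem_ball.mp hzb).trans hm
      have h2 : dist (x i : ℂ) ζ < δ / 2 := by rw [dist_comm]; exact hi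
      rw [Metric.mem_ball]
      linarith [dist_triangle z (x i : ℂ) ζ]
    have : CompactSpace K' := isCompact_iff_compactSpace.mp hK'c
    let φK : C(K', ℂ) := ⟨K'.domRestrict φ', hφ'.domRestrict⟩
    have hopen : IsOpen {F : C(ℂ, ℂ) | F.restrict K' ∈ Metric.ball φK ε} :=
      Metric.isOpen_ball.preimage (ContinuousMap.continuous_restrict K')
    obtain ⟨F₀, hF₀⟩ := ContinuousMap.exists_restrict_eq hK'c.isClosed φK
    obtain ⟨p, hp⟩ := (TopologicalSpace.denseRange_denseSeq C(ℂ, ℂ)).exists_mem_open hopen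
      ⟨F₀, by simp [hF₀, hε]⟩
    have hp' : ∀ z ∈ K', ‖TopologicalSpace.denseSeq C(ℂ, ℂ) p z - φ' z‖ < ε := by
      intro z hz
      have := (ContinuousMap.dist_lt_iff hε).mp (Metric.mem_ball.mp hp) ⟨z, hz⟩
      rw [dist_eq_norm] at this
      exact this
    refine Filter.frequently_atTop.mpr fun a =>
      ⟨Nat.pair (Encodable.encode (i, m, p)) a, Nat.right_le_pair _ _, ?_⟩
    have hT : T (Nat.pair (Encodable.encode (i, m, p)) a) = (i, m, p) := by
      simp only [T, Nat.unpair_pair, Denumerable.ofNat_encode]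
    simp only [hT]
    exact ⟨hsub, hp'⟩

/-! ### Passage to the limit -/

open Polynomial in
theorem Polynomial.iteratedDeriv_eval_zero (p : ℂ[X]) (k : ℕ) :
    iteratedDeriv k (fun z => p.eval z) 0 = k.factorial * p.coeff k := by
  have h : ∀ k : ℕ, iteratedDeriv k (fun z => p.eval z) = fun z => (derivative^[k] p).eval z := by
    intro k
    induction k with
    | zero => simp
    | succ k ih =>
      rw [iteratedDeriv_succ, ih, Function.iterate_succ_apply']
      ext z
      exact Polynomial.deriv _
  rw [h]
  change (derivative^[k] p).eval 0 = _
  rw [← coeff_zero_eq_eval_zero, coeff_iterate_derivative, zero_add, Nat.descFactorial_self,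
    nsmul_eq_mul]

theorem TendstoLocallyUniformlyOn.iteratedDeriv {ι : Type*} {φ : Filter ι} {F : ι → ℂ → ℂ}
    {f : ℂ → ℂ} {U : Set ℂ} (hf : TendstoLocallyUniformlyOn F f φ U)
    (hF : ∀ n, DifferentiableOn ℂ (F n) U) (hU : IsOpen U) (k : ℕ) :
    TendstoLocallyUniformlyOn (fun n => iteratedDeriv k (F n)) (iteratedDeriv k f) φ U := by
  induction k generalizing F f with
  | zero => simpa using hf
  | succ k ih =>
    simp only [iteratedDeriv_succ']
    exact ih (hf.deriv (Eventually.of_forall hF) hU) fun n => (hF n).deriv hU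

open Polynomial in
/-- A sequence of polynomials whose successive differences have increasing orders of vanishing at
`0` and are summably small on discs exhausting the unit disc converges in the unit disc to a
holomorphic function having these polynomials as Taylor sections. -/
theorem exists_limit_of_polynomials {Q : ℕ → ℂ[X]} {M : ℕ → ℕ} (hM : StrictMono M)
    (hdeg : ∀ j, (Q j).natDegree < M j)
    (hcoeff : ∀ j, ∀ k < M j, (Q (j + 1)).coeff k = (Q j).coeff k) {r : ℕ → ℝ}
    (hr : Tendsto r atTop (𝓝 1))
    (hsmall : ∀ j z, ‖z‖ ≤ r j → ‖(Q (j + 1)).eval z - (Q j).eval z‖ ≤ (1 / 2) ^ j) :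
    ∃ f : ℂ → ℂ, DifferentiableOn ℂ f (Metric.ball 0 1) ∧
      (∀ j, ∀ k < M j, iteratedDeriv k f 0 = k.factorial * (Q j).coeff k) ∧
      ∀ j z, taylorPartialSum f (M j - 1) z = (Q j).eval z := by
  let f : ℂ → ℂ := fun z => (Q 0).eval z + ∑' j, ((Q (j + 1)).eval z - (Q j).eval z)
  have hlim : TendstoLocallyUniformlyOn (fun j z => (Q j).eval z) f atTop (Metric.ball 0 1) := by
    intro u hu z hz
    obtain ⟨R, hzR, hR1⟩ := exists_between (mem_ball_zero_iff.mp hz)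
    refine ⟨Metric.ball 0 R, mem_nhdsWithin_of_mem_nhds
      (Metric.isOpen_ball.mem_nhds (mem_ball_zero_iff.mpr hzR)), ?_⟩
    have hsum : Summable fun j : ℕ => (1 / 2 : ℝ) ^ j := summable_geometric_two
    -- The geometric bound holds on this ball only once `r j > R`, hence the eventual form of the
    -- M-test.
    have h := tendstoUniformlyOn_tsum_nat_eventually (s := Metric.ball (0 : ℂ) R)
      (f := fun j z => (Q (j + 1)).eval z - (Q j).eval z) hsum (by
        filter_upwards [hr.eventually_const_lt hR1] with j hj y hy
        exact hsmall j y ((mem_ball_zero_iff.mp hy).le.trans hj.le))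
    have h' : TendstoUniformlyOn (fun j z => (Q j).eval z) f atTop (Metric.ball 0 R) := by
      rw [Metric.tendstoUniformlyOn_iff] at h ⊢
      intro ε hε
      filter_upwards [h ε hε] with j hj y hy
      have := hj y hy
      rw [Finset.sum_range_sub (fun j => (Q j).eval y)] at this
      rw [← dist_sub_right _ _ ((Q 0).eval y)]
      simpa [f] using this
    exact h' u hu
  have hstable : ∀ j i, j ≤ i → ∀ k < M j, (Q i).coeff k = (Q j).coeff k := by
    intro j i hji k hk
    induction i, hji using Nat.le_induction with
    | base => rfl
    | succ i hi ih => rw [hcoeff i k (hk.trans_le (hM.monotone hi)), ih]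
  have hderiv : ∀ j, ∀ k < M j, iteratedDeriv k f 0 = k.factorial * (Q j).coeff k := by
    intro j k hk
    have h := (hlim.iteratedDeriv (fun n => (Q n).differentiable.differentiableOn)
      Metric.isOpen_ball k).tendsto_at (Metric.mem_ball_self one_pos)
    refine tendsto_nhds_unique h (tendsto_const_nhds.congr' ?_)
    filter_upwards [eventually_ge_atTop j] with i hi
    rw [Polynomial.iteratedDeriv_eval_zero, hstable j i hi k hk]
  refine ⟨f, hlim.differentiableOn (Eventually.of_forall fun n =>
    (Q n).differentiable.differentiableOn) Metric.isOpen_ball, hderiv, fun j z => ?_⟩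
  have hMj := hdeg j
  rw [taylorPartialSum, Nat.sub_add_cancel (by omega), eval_eq_sum_range' hMj]
  refine Finset.sum_congr rfl fun k hk => ?_
  rw [hderiv j k (Finset.mem_range.mp hk),
    mul_div_cancel_left₀ _ (by exact_mod_cast k.factorial_ne_zero)]

-- Iterates the inductive step from `X ^ l`, whose weighted sums equal `l!` from `n = l + 1` on;
-- shorter sums always vanish.
open Polynomial in
theorem exists_seq_polynomials {l : ℕ} (hl : 1 ≤ l) {K : ℕ → Set ℂ} (φ : ℕ → C(ℂ, ℂ))
    (hK : ∀ j, IsCompact (K j) ∧ K j ⊆ Metric.sphere 0 1 ∧ K j ≠ Metric.sphere 0 1)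
    {r : ℕ → ℝ} (hr : ∀ j, 0 < r j ∧ r j < 1) :
    ∃ (Q : ℕ → ℂ[X]) (M : ℕ → ℕ), StrictMono M ∧ (∀ j, (Q j).natDegree < M j) ∧
      (∀ j, ∀ k < M j, (Q (j + 1)).coeff k = (Q j).coeff k) ∧
      (∀ j z, ‖z‖ ≤ r j → ‖(Q (j + 1)).eval z - (Q j).eval z‖ ≤ (1 / 2) ^ j) ∧
      (∀ j, ∀ z ∈ K j, ‖(Q (j + 1)).eval z - φ j z‖ ≤ (1 / 2) ^ j) ∧
      ∀ j, ∀ n ≥ l + 1, 1 ≤ ‖∑ k ∈ Finset.range n, (k.descFactorial l : ℂ) * (Q j).coeff k‖ := by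
  let σ := {s : ℂ[X] × ℕ // s.1.natDegree < s.2 ∧
    ∀ n ≥ l + 1, 1 ≤ ‖∑ k ∈ Finset.range n, (k.descFactorial l : ℂ) * s.1.coeff k‖}
  have step : ∀ (j : ℕ) (s : σ), ∃ s' : σ, s.1.2 < s'.1.2 ∧
      (∀ k < s.1.2, s'.1.1.coeff k = s.1.1.coeff k) ∧
      (∀ z, ‖z‖ ≤ r j → ‖s'.1.1.eval z - s.1.1.eval z‖ ≤ (1 / 2) ^ j) ∧
      ∀ z ∈ K j, ‖s'.1.1.eval z - φ j z‖ ≤ (1 / 2) ^ j := by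
    rintro j ⟨⟨Q, M⟩, hd, hQ⟩
    obtain ⟨R, h1, h2, h3, h4⟩ := exists_polynomial_approx_of_one_le_norm hl hQ M (hK j).1
      (hK j).2.1 (hK j).2.2 (φ j).continuous.continuousOn (hr j).1 (hr j).2
      (ε := (1 / 2) ^ j) (by positivity)
    refine ⟨⟨(R, max M R.natDegree + 1), Nat.lt_succ_of_le (le_max_right _ _), h4⟩,
      Nat.lt_succ_of_le (le_max_left _ _), h1, h2, h3⟩
  choose next h1 h2 h3 h4 using step
  have hinit : ∀ n ≥ l + 1,
      1 ≤ ‖∑ k ∈ Finset.range n, (k.descFactorial l : ℂ) * (X ^ l : ℂ[X]).coeff k‖ := by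
    intro n hn
    simp only [coeff_X_pow, mul_ite, mul_one, mul_zero]
    rw [Finset.sum_ite_eq', if_pos (Finset.mem_range.mpr hn), Nat.descFactorial_self,
      Complex.norm_natCast]
    exact_mod_cast Nat.one_le_iff_ne_zero.mpr l.factorial_ne_zero
  let s : ℕ → σ := fun n => Nat.rec ⟨(X ^ l, l + 1), by simp, hinit⟩ next n
  exact ⟨fun j => (s j).1.1, fun j => (s j).1.2, strictMono_nat_of_lt_succ fun j => h1 j (s j),
    fun j => (s j).2.1, fun j => h2 j (s j), fun j => h3 j (s j), fun j => h4 j (s j),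
    fun j => (s j).2.2⟩

/-! ### Partial sums of the derivative at `1`, and the conclusion -/

theorem iteratedDeriv_iteratedDeriv (f : ℂ → ℂ) (k l : ℕ) :
    iteratedDeriv k (iteratedDeriv l f) = iteratedDeriv (k + l) f := by
  simp only [iteratedDeriv_eq_iterate, Function.iterate_add_apply]

/-- The partial sums at `1` of the `l`-th derivative in terms of the coefficients of `f`. -/
theorem taylorPartialSum_iteratedDeriv_one (f : ℂ → ℂ) (l n : ℕ) :
    taylorPartialSum (iteratedDeriv l f) n 1 = ∑ k ∈ Finset.range (n + 1 + l),
      (k.descFactorial l : ℂ) * (iteratedDeriv k f 0 / k.factorial) := by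
  rw [add_comm (n + 1) l, Finset.sum_range_add, Finset.sum_eq_zero (s := Finset.range l), zero_add]
  · refine Finset.sum_congr rfl fun k _ => ?_
    have h := Nat.factorial_mul_descFactorial (Nat.le_add_right l k)
    rw [Nat.add_sub_cancel_left] at h
    have h' : ((l + k).factorial : ℂ) = k.factorial * (l + k).descFactorial l := by
      exact_mod_cast h.symm
    have h0 : ((l + k).factorial : ℂ) ≠ 0 := by exact_mod_cast (l + k).factorial_ne_zero
    rw [h'] at h0 ⊢
    have h0' := left_ne_zero_of_mul h0
    have h0'' := right_ne_zero_of_mul h0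
    rw [iteratedDeriv_iteratedDeriv, one_pow, mul_one, add_comm k l]
    field_simp
  · intro k hk
    rw [Nat.descFactorial_of_lt (Finset.mem_range.mp hk), Nat.cast_zero, zero_mul]

theorem theorem4p3 (l : ℕ) (hl : 1 ≤ l) :
    ∃ f ∈ TUniversalTaylorSeries, iteratedDeriv l f ∉ TUniversalTaylorSeries := by
  obtain ⟨K, φ, hK, hφ⟩ := exists_seq_approximation_problems
  -- The shift by `2` keeps the radius positive at `j = 0`.
  have hr : ∀ j : ℕ, (0 : ℝ) < 1 - 1 / ((j : ℝ) + 2) ∧ 1 - 1 / ((j : ℝ) + 2) < 1 := by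
    intro j
    have h0 : (0 : ℝ) < 1 / ((j : ℝ) + 2) := by positivity
    have h1 : 1 / ((j : ℝ) + 2) < 1 := by
      rw [div_lt_one (by positivity)]
      linarith [(Nat.cast_nonneg j : (0 : ℝ) ≤ j)]
    exact ⟨by linarith, by linarith⟩
  obtain ⟨Q, M, hM, hdeg, hcoeff, hsmall, happ, hlow⟩ := exists_seq_polynomials hl φ hK hr
  have hrlim : Tendsto (fun j : ℕ => 1 - 1 / ((j : ℝ) + 2)) atTop (𝓝 1) := by
    have h : Tendsto (fun j : ℕ => 1 / ((j : ℝ) + 2)) atTop (𝓝 0) := by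
      simp only [one_div]
      exact tendsto_inv_atTop_zero.comp
        (tendsto_atTop_add_const_right _ _ tendsto_natCast_atTop_atTop)
    simpa using h.const_sub 1
  obtain ⟨f, hf, hfk, hfS⟩ := exists_limit_of_polynomials hM hdeg hcoeff hrlim hsmall
  refine ⟨f, ⟨hf, fun K' hK'c hK' hne φ' hφ' => ?_⟩, fun hfl => ?_⟩
  · have hfreq : ∀ n : ℕ, ∃ᶠ k in atTop, ∀ z ∈ K', ‖taylorPartialSum f k z - φ' z‖ < 1 / (n + 1) := by
      intro n
      have hε : (0 : ℝ) < 1 / (n + 1) / 2 := by positivity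
      have hpow : ∀ᶠ j : ℕ in atTop, (1 / 2 : ℝ) ^ j < 1 / (n + 1) / 2 :=
        (tendsto_pow_atTop_nhds_zero_of_lt_one (by norm_num) (by norm_num)).eventually_lt_const hε
      have hMt : Tendsto (fun j => M (j + 1) - 1) atTop atTop :=
        tendsto_atTop_mono (fun j => Nat.le_sub_one_of_lt (hM.le_apply.trans_lt
          (hM (Nat.lt_succ_self j)))) tendsto_id
      refine hMt.frequently (((hφ K' hK'c hK' hne φ' hφ' _ hε).and_eventually hpow).mono ?_)
      rintro j ⟨⟨hsub, hj⟩, hj2⟩ z hz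
      rw [hfS]
      have h1 := happ j z (hsub hz)
      have h2 := hj z hz
      have h3 := norm_sub_le_norm_sub_add_norm_sub ((Q (j + 1)).eval z) (φ j z) (φ' z)
      linarith
    obtain ⟨u, hu, huP⟩ := extraction_forall_of_frequently hfreq
    refine ⟨u, hu, Metric.tendstoUniformlyOn_iff.mpr fun ε hε => ?_⟩
    filter_upwards [tendsto_one_div_add_atTop_nhds_zero_nat.eventually_lt_const hε] with n hn z hz
    rw [dist_comm, dist_eq_norm]
    exact (huP n z hz).trans hn
  · have hne : ({1} : Set ℂ) ≠ Metric.sphere 0 1 := by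
      intro h
      have h1 : (-1 : ℂ) ∈ ({1} : Set ℂ) := by rw [h]; simp
      norm_num at h1
    obtain ⟨u, hu, hlim⟩ := hfl.2 {1} isCompact_singleton (by simp) hne 0 continuousOn_const
    have h1 := (hlim.tendsto_at (Set.mem_singleton 1)).norm
    rw [Pi.zero_apply, norm_zero] at h1
    obtain ⟨n, hn, hn1⟩ := ((h1.eventually_lt_const one_pos).and (eventually_ge_atTop 1)).exists
    refine hn.not_ge ?_
    rw [taylorPartialSum_iteratedDeriv_one]
    -- Since `M j ≥ j`, the polynomial of index `u n + 1 + l` already has all the coefficients in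
    -- this sum.
    have hle : u n + 1 + l ≤ M (u n + 1 + l) := hM.le_apply
    rw [Finset.sum_congr rfl fun k hk => by
      rw [hfk (u n + 1 + l) k ((Finset.mem_range.mp hk).trans_le hle),
        mul_div_cancel_left₀ _ (by exact_mod_cast k.factorial_ne_zero)]]
    exact hlow _ _ (by omega)
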